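/- Let $G=(V,w)$ be a finite metric space. An input $\sigma$ is a finite collection of requests $([r,d],v)$ with integers $r,d\ge 0$ and $v\in V$; the request becomes known at time $r$. A single server moves in $G$, needs time $w(u,v)$ to travel from $u$ to $v$ and one unit of time to serve a request at its node, and the service must lie within the window $[r,d]$. $\mathrm{OPT}(\sigma)$ is the maximum number of requests that can be served in a feasible schedule (with a free choice of the initial position), and $\mathrm{ALG}(\sigma)$ is the number served by the algorithm. Let $L$ be a lower bound, known to the algorithm, on the length $d-r$ of all windows (for example the minimum laxity). Let $\mathrm{TSP}(G)$ be the minimum weight of a closed tour through all nodes of $G$, or alternatively (the result holds for each of the two conventions, used consistently) the minimum weight of a path through all nodes. The algorithm TSP-EDF works in phases of length $K=\sqrt{\mathrm{TSP}(G)\,L}$; phase $\ell=1,2,\dots$ is $[K(\ell-1),K\ell]$. Deadlines are decreased from $d$ to $K\lfloor d/K\rfloor$. At the beginning of phase $\ell$, let $R^\ell$ be the set of requests that have arrived by then, that were neither served nor dropped in an earlier phase, and whose decreased deadline is at least $K\ell$. Let $S^\ell$ be the first $\lfloor K\rfloor$ requests of $R^\ell$ in earliest-deadline-first order with respect to the decreased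 deadlines (ties broken by a fixed labelling of the requests). During the phase the server, starting from its current position, serves the requests of $S^\ell$ node by node, the nodes being taken in the order of a fixed minimum TSP path or tour (by label within a node), moving directly from node to node; the requests of $S^\ell$ whose service would not be completed by time $K\ell$ are dropped for good. **Theorem.** There is an absolute constant $C>0$ such that for every finite metric space $G$ with $\mathrm{TSP}(G)\ge 1$ (for instance any metric space with at least two nodes and integer distances), every $L>10\,\mathrm{TSP}(G)$, every choice of a minimum TSP order and every initial position of the server, TSP-EDF is a deterministic online algorithm, it produces a feasible schedule on every input, and $$\mathrm{OPT}(\sigma)\le\Bigl(1+C\sqrt{\mathrm{TSP}(G)/L}\Bigr)\,\mathrm{ALG}(\sigma)$$ for every input $\sigma$ all of whose windows have length at least $L$. -/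

import Mathlib

/-- A request `([release, deadline], node)` for one unit of service at `node`. -/
structure Request (V : Type*) where
  release : ℕ
  deadline : ℕ
  node : V

/-- A finite input: the requests are `req i` for the labels `i ∈ ids`. Several labels may carry
equal requests; the value of `req` outside `ids` is irrelevant. -/
structure RequestSeq (V : Type*) where
  ids : Finset ℕ
  req : ℕ → Request V

/-- A schedule is a set of services `(i, s)`: the request with label `i` is served during the
time interval `[s, s + 1]`. -/
abbrev Schedule : Type := Set (ℕ × ℝ)

/-- A schedule is feasible if it serves only requests of the input, each at most once and within
its time window, and if there is enough time between services for the server to travel.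
(By the triangle inequality it is the same to ask for the travel time for all pairs of services
or only for successive ones.) -/
structure Feasible {V : Type*} [MetricSpace V] (σ : RequestSeq V) (A : Schedule) : Prop where
  mem_ids : ∀ x ∈ A, x.1 ∈ σ.ids
  release_le : ∀ x ∈ A, ((σ.req x.1).release : ℝ) ≤ x.2
  le_deadline : ∀ x ∈ A, x.2 + 1 ≤ ((σ.req x.1).deadline : ℝ)
  once : ∀ x ∈ A, ∀ y ∈ A, x.1 = y.1 → x = y
  travel : ∀ x ∈ A, ∀ y ∈ A, x ≠ y → x.2 ≤ y.2 →
    x.2 + 1 + dist (σ.req x.1).node (σ.req y.1).node ≤ y.2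

/-- The number of requests served by a (feasible, hence finite) schedule. -/
noncomputable def throughput (A : Schedule) : ℕ := A.ncard

/-- The optimal offline throughput. -/
noncomputable def opt {V : Type*} [MetricSpace V] (σ : RequestSeq V) : ℕ :=
  sSup {m : ℕ | ∃ A : Schedule, Feasible σ A ∧ throughput A = m}

/-- The supremum in the definition of `opt` is a maximum. -/
theorem opt_isGreatest {V : Type*} [MetricSpace V] (σ : RequestSeq V) :
    IsGreatest {m : ℕ | ∃ A : Schedule, Feasible σ A ∧ throughput A = m} (opt σ) := by
  have hb : BddAbove {m : ℕ | ∃ A : Schedule, Feasible σ A ∧ throughput A = m} := by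
    refine ⟨σ.ids.card, ?_⟩
    rintro m ⟨A, hA, rfl⟩
    have h := Set.ncard_le_ncard_of_injOn (s := A) (t := (σ.ids : Set ℕ)) Prod.fst
      (fun x hx => hA.mem_ids x hx) (fun x hx y hy h => hA.once x hx y hy h)
      σ.ids.finite_toSet
    simpa [throughput, Set.ncard_coe_finset] using h
  have hne : {m : ℕ | ∃ A : Schedule, Feasible σ A ∧ throughput A = m}.Nonempty :=
    ⟨_, ∅, ⟨by simp, by simp, by simp, by simp, by simp⟩, rfl⟩
  exact ⟨Nat.sSup_mem hne hb, fun m hm => le_csSup hb hm⟩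

/-- Every time window of the input has length at least `L`. -/
def HasLaxity {V : Type*} (L : ℝ) (σ : RequestSeq V) : Prop :=
  ∀ i ∈ σ.ids, L ≤ ((σ.req i).deadline : ℝ) - ((σ.req i).release : ℝ)

/-- The inputs `σ` and `τ` contain the same requests among those that arrive by time `t`. -/
def AgreeUpTo {V : Type*} (t : ℝ) (σ τ : RequestSeq V) : Prop :=
  (∀ i ∈ σ.ids, ((σ.req i).release : ℝ) ≤ t → i ∈ τ.ids ∧ τ.req i = σ.req i) ∧
  (∀ i ∈ τ.ids, ((τ.req i).release : ℝ) ≤ t → i ∈ σ.ids ∧ σ.req i = τ.req i)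

/-- A deterministic algorithm is online if the services it starts up to any time `t` depend only
on the requests that arrive up to time `t`. -/
def IsOnline {V : Type*} (alg : RequestSeq V → Schedule) : Prop :=
  ∀ (t : ℝ) (σ τ : RequestSeq V), AgreeUpTo t σ τ →
    ∀ (i : ℕ) (s : ℝ), s ≤ t → ((i, s) ∈ alg σ ↔ (i, s) ∈ alg τ)

/-- The algorithm has competitive ratio at most `c` on the inputs of minimum laxity at least
`L`. -/
def IsCompetitive {V : Type*} [MetricSpace V] (alg : RequestSeq V → Schedule) (L c : ℝ) : Prop :=
  ∀ σ : RequestSeq V, HasLaxity L σ → (opt σ : ℝ) ≤ c * (throughput (alg σ) : ℝ)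

/-- The two usual versions of the travelling salesperson problem: visit all nodes along a path, or
along a closed tour. -/
inductive TSPKind : Type
  | path
  | tour

/-- The length of the path that visits the nodes of a list in the given order. -/
noncomputable def pathLength {V : Type*} [MetricSpace V] : List V → ℝ
  | [] => 0
  | [_] => 0
  | u :: v :: l => dist u v + pathLength (v :: l)

/-- The length of the path, or of the closed tour, through the nodes of a list. -/
noncomputable def routeLength {V : Type*} [MetricSpace V] : TSPKind → List V → ℝ
  | TSPKind.path, l => pathLength l
  | TSPKind.tour, [] => 0
  | TSPKind.tour, u :: l => pathLength (u :: l ++ [u])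

/-- The list contains every node exactly once. -/
def IsNodeOrder {V : Type*} (l : List V) : Prop :=
  l.Nodup ∧ ∀ v : V, v ∈ l

/-- `TSP(G)`, the minimum weight of a path (or of a closed tour) through all nodes. -/
noncomputable def tspWeight (V : Type*) [Fintype V] [MetricSpace V] (kind : TSPKind) : ℝ :=
  sInf {w : ℝ | ∃ l : List V, IsNodeOrder l ∧ routeLength kind l = w}

/-- The list is the order of the nodes in a minimum path (or closed tour). -/
def IsMinimalTSP {V : Type*} [Fintype V] [MetricSpace V] (kind : TSPKind) (l : List V) : Prop :=
  IsNodeOrder l ∧ routeLength kind l = tspWeight V kind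

/-- The decreased deadline `K ⌊d / K⌋`. -/
noncomputable def decreasedDeadline {V : Type*} (K : ℝ) (q : Request V) : ℝ :=
  K * (⌊(q.deadline : ℝ) / K⌋ : ℝ)

/-- Phases are numbered from `0`; phase `p` is the time interval `[K p, K (p + 1)]`.
These are the requests available to phase `p`: they have arrived by the beginning of the phase,
have not been handled (served or dropped) by an earlier phase, and their decreased deadline is not
before the end of the phase. -/
noncomputable def availableRequests {V : Type*} (K : ℝ) (σ : RequestSeq V) (p : ℕ)
    (handled : Finset ℕ) : Finset ℕ :=
  σ.ids.filter (fun i => i ∉ handled ∧ ((σ.req i).release : ℝ) ≤ K * (p : ℝ) ∧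
    K * ((p : ℝ) + 1) ≤ decreasedDeadline K (σ.req i))

/-- `j` precedes `i` in earliest-deadline-first order for the decreased deadlines; ties are broken
by label. -/
def edfBefore {V : Type*} (K : ℝ) (σ : RequestSeq V) (j i : ℕ) : Prop :=
  decreasedDeadline K (σ.req j) < decreasedDeadline K (σ.req i) ∨
    (decreasedDeadline K (σ.req j) = decreasedDeadline K (σ.req i) ∧ j < i)

open Classical in
/-- The prefix of length `K` of the earliest-deadline-first schedule of the set `R`, that is, its
first `⌊K⌋` requests (each takes one unit of time). -/
noncomputable def edfPrefix {V : Type*} (K : ℝ) (σ : RequestSeq V) (R : Finset ℕ) : Finset ℕ :=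
  R.filter (fun i => (R.filter (fun j => edfBefore K σ j i)).card < ⌊K⌋₊)

open Classical in
/-- The requests of `S`, node by node in the order of the list `order`. -/
noncomputable def nodeByNode {V : Type*} (σ : RequestSeq V) (order : List V) (S : Finset ℕ) :
    List ℕ :=
  order.flatMap (fun v => (S.filter (fun i => (σ.req i).node = v)).sort (· ≤ ·))

/-- The server is at `pos` at time `t` and serves the requests of the list in turn, moving directly
from node to node, as long as the service is completed by the time `finish`; the remaining
requests of the list are dropped. -/
noncomputable def serveUntil {V : Type*} [MetricSpace V] (σ : RequestSeq V) (finish : ℝ) :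
    V → ℝ → List ℕ → List (ℕ × ℝ)
  | _, _, [] => []
  | pos, t, i :: l =>
    if t + dist pos (σ.req i).node + 1 ≤ finish then
      (i, t + dist pos (σ.req i).node) ::
        serveUntil σ finish (σ.req i).node (t + dist pos (σ.req i).node + 1) l
    else []

/-- What the algorithm remembers at the beginning of a phase: the position of the server and the
requests that were served or dropped in earlier phases. -/
structure ServerState (V : Type*) where
  pos : V
  handled : Finset ℕ

/-- The requests selected at the beginning of phase `p`. -/
noncomputable def phaseSelection {V : Type*} (K : ℝ) (σ : RequestSeq V) (p : ℕ)
    (st : ServerState V) : Finset ℕ :=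
  edfPrefix K σ (availableRequests K σ p st.handled)

/-- The services of phase `p`. -/
noncomputable def phaseServices {V : Type*} [MetricSpace V] (K : ℝ) (order : List V)
    (σ : RequestSeq V) (p : ℕ) (st : ServerState V) : List (ℕ × ℝ) :=
  serveUntil σ (K * ((p : ℝ) + 1)) st.pos (K * (p : ℝ))
    (nodeByNode σ order (phaseSelection K σ p st))

/-- The state at the beginning of each phase, for a server that starts at the node `v₀`. After a
phase, the server stays at the node that it served last. -/
noncomputable def phaseState {V : Type*} [MetricSpace V] (K : ℝ) (order : List V) (v₀ : V)
    (σ : RequestSeq V) : ℕ → ServerState V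
  | 0 => ⟨v₀, ∅⟩
  | p + 1 =>
    let st := phaseState K order v₀ σ p
    ⟨((phaseServices K order σ p st).getLast?.map (fun x => (σ.req x.1).node)).getD st.pos,
      st.handled ∪ phaseSelection K σ p st⟩

/-- The phase algorithm with phase length `K`: the services of all phases. -/
noncomputable def phaseSchedule {V : Type*} [MetricSpace V] (K : ℝ) (order : List V) (v₀ : V)
    (σ : RequestSeq V) : Schedule :=
  {x | ∃ p : ℕ, x ∈ phaseServices K order σ p (phaseState K order v₀ σ p)}

/-- The algorithm TSP-EDF, with phases of length `√(TSP(G) · L)`. -/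
noncomputable def tspEDF {V : Type*} [Fintype V] [MetricSpace V] (kind : TSPKind) (L : ℝ)
    (order : List V) (v₀ : V) : RequestSeq V → Schedule :=
  phaseSchedule (Real.sqrt (tspWeight V kind * L)) order v₀

/-!
Let `T` be the weight of a minimum path or tour and put `e = √(T / L)`, so that the phase length is
`K = √(T * L)` with `T = e * K` and `K = e * L`. The algorithm loses a fraction `O(e)` at two
places.

*Within a phase.* At most `⌊K⌋` requests are selected. Following the minimum path or tour costs the
server at most `T`, and getting to its first node at most another `T`
(`pathLength_nodeByNode_le`). Hence the phase serves all that it selects, or at least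
`⌊K - 2 * T⌋` requests (`min_le_length_phaseServices`), which is a fraction `1 - O(e)` of `K`
because `1 ≤ T`.

*In the selection.* The selections form an earliest-deadline-first schedule of rounds of `⌊K⌋`
requests, in which a request with window `[r, d]` may be put into the rounds from `⌈r / K⌉` until
before `⌊d / K⌋`. In such a schedule requests remain unselected only inside intervals of rounds
that are full of requests whose own rounds lie inside the interval
(`card_le_mul_sum_card_of_edf`). If such an interval has `n` rounds, then the optimal schedule
serves at most `K * (n + 2)` requests confined to it, since their windows lie in a time interval
of that length (`Feasible.card_le_sub`), while the algorithm selects `⌊K⌋ * n`. As the interval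
contains a window of length at least `L`, it has `n > 1 / e - 2`, and the ratio of the two numbers
is `1 + O(e)` (`opt_le_mul_sum_card_phaseSelection`).

That the algorithm is online follows from the fact that phase `p` uses only requests released by
its beginning, no later than any of its services. Feasibility between different phases holds
because at the end of a phase the server rests at the last node it served
(`end_add_dist_pos_le`).
-/

/-! ### Lengths of paths -/

theorem pathLength_nonneg {V : Type*} [MetricSpace V] : ∀ l : List V, 0 ≤ pathLength l
  | [] => le_rfl
  | [_] => le_rfl
  | _ :: v :: l => add_nonneg dist_nonneg (pathLength_nonneg (v :: l))

theorem pathLength_cons_le {V : Type*} [MetricSpace V] (u v : V) (l : List V) :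
    pathLength (u :: l) ≤ dist u v + pathLength (v :: l) := by
  cases l with
  | nil => simp [pathLength]
  | cons w l =>
    simp only [pathLength]
    linarith [dist_triangle u v w]

theorem pathLength_le_append {V : Type*} [MetricSpace V] (l' : List V) :
    ∀ l : List V, pathLength l ≤ pathLength (l ++ l')
  | [] => pathLength_nonneg _
  | [_] => pathLength_nonneg _
  | u :: v :: l => by
    have h := pathLength_le_append l' (v :: l)
    simp only [List.cons_append, pathLength] at h ⊢
    linarith

theorem pathLength_le_routeLength {V : Type*} [MetricSpace V] (kind : TSPKind) (l : List V) :
    pathLength l ≤ routeLength kind l := by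
  cases kind with
  | path => exact le_rfl
  | tour =>
    cases l with
    | nil => exact le_rfl
    | cons u l => exact pathLength_le_append [u] (u :: l)

theorem dist_le_pathLength_of_mem {V : Type*} [MetricSpace V] (v : V) :
    ∀ (l : List V) (u : V), v ∈ u :: l → dist u v ≤ pathLength (u :: l)
  | [], u, h => by
    rw [List.mem_singleton] at h
    simp [h, pathLength]
  | w :: l, u, h => by
    rcases List.mem_cons.1 h with rfl | h
    · simpa using pathLength_nonneg _
    · have := dist_le_pathLength_of_mem v l w h
      simp only [pathLength] at this ⊢
      linarith [dist_triangle u w v]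

/-- A stay at `v` of any length, possibly empty, costs no more than a visit of `v`. -/
theorem pathLength_cons_append_le {V : Type*} [MetricSpace V] (v : V) (rest : List V) :
    ∀ (l : List V), (∀ x ∈ l, x = v) → ∀ u : V,
      pathLength (u :: (l ++ rest)) ≤ dist u v + pathLength (v :: rest)
  | [], _, u => pathLength_cons_le u v rest
  | x :: l, h, u => by
    obtain rfl := h x List.mem_cons_self
    have := pathLength_cons_append_le x rest l (fun y hy => h y (List.mem_cons_of_mem _ hy)) x
    rw [dist_self] at this
    simp only [List.cons_append, pathLength]
    linarith

theorem pathLength_cons_flatMap_le {V : Type*} [MetricSpace V] (f : V → List V)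
    (hf : ∀ v, ∀ x ∈ f v, x = v) :
    ∀ (l : List V) (u : V), pathLength (u :: l.flatMap f) ≤ pathLength (u :: l)
  | [], u => le_rfl
  | v :: l, u => by
    have h1 := pathLength_cons_append_le v (l.flatMap f) (f v) (hf v) u
    have h2 := pathLength_cons_flatMap_le f hf l v
    simp only [List.flatMap_cons, pathLength]
    linarith

/-- From any position, the requests of a set are reached node by node within twice the weight of a
minimum path or tour: once to get to its first node and once to follow it. -/
theorem pathLength_nodeByNode_le {V : Type*} [Fintype V] [MetricSpace V] {kind : TSPKind}
    {order : List V} (h : IsMinimalTSP kind order) (σ : RequestSeq V) (S : Finset ℕ) (pos : V) :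
    pathLength (pos :: (nodeByNode σ order S).map (fun i => (σ.req i).node)) ≤
      2 * tspWeight V kind := by
  classical
  obtain ⟨⟨-, hmem⟩, hlen⟩ := h
  have hroute := pathLength_le_routeLength kind order
  rw [hlen] at hroute
  have hflat := pathLength_cons_flatMap_le
    (fun v => ((S.filter (fun i => (σ.req i).node = v)).sort (· ≤ ·)).map
      (fun i => (σ.req i).node))
    (by
      intro v x hx
      obtain ⟨i, hi, rfl⟩ := List.mem_map.1 hx
      rw [Finset.mem_sort, Finset.mem_filter] at hi
      exact hi.2) order pos
  have heq : (nodeByNode σ order S).map (fun i => (σ.req i).node) = order.flatMap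
      (fun v => ((S.filter (fun i => (σ.req i).node = v)).sort (· ≤ ·)).map
        (fun i => (σ.req i).node)) := by
    rw [nodeByNode, List.map_flatMap]
  rw [heq]
  refine hflat.trans ?_
  cases order with
  | nil => exact absurd (hmem pos) List.not_mem_nil
  | cons u l =>
    have := dist_le_pathLength_of_mem pos l u (hmem pos)
    rw [dist_comm] at this
    simp only [pathLength]
    linarith

theorem mem_nodeByNode {V : Type*} {σ : RequestSeq V} {order : List V} {S : Finset ℕ}
    (h : IsNodeOrder order) {i : ℕ} : i ∈ nodeByNode σ order S ↔ i ∈ S := by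
  simp [nodeByNode, h.2]

theorem nodup_nodeByNode {V : Type*} (σ : RequestSeq V) {order : List V} (S : Finset ℕ)
    (h : IsNodeOrder order) : (nodeByNode σ order S).Nodup := by
  rw [nodeByNode, List.nodup_flatMap]
  refine ⟨fun v _ => Finset.sort_nodup _ _, h.1.imp ?_⟩
  intro u v huv i hi hi'
  simp only [Finset.mem_sort, Finset.mem_filter] at hi hi'
  exact huv (hi.2.symm.trans hi'.2)

theorem length_nodeByNode {V : Type*} (σ : RequestSeq V) {order : List V} (S : Finset ℕ)
    (h : IsNodeOrder order) : (nodeByNode σ order S).length = S.card := by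
  rw [← List.toFinset_card_of_nodup (nodup_nodeByNode σ S h)]
  congr 1
  ext i
  rw [List.mem_toFinset, mem_nodeByNode h]

/-! ### Serving a list of requests -/

theorem map_fst_serveUntil_prefix {V : Type*} [MetricSpace V] (σ : RequestSeq V) (finish : ℝ) :
    ∀ (l : List ℕ) (pos : V) (t : ℝ), (serveUntil σ finish pos t l).map Prod.fst <+: l
  | [], _, _ => List.prefix_rfl
  | i :: l, pos, t => by
    rw [serveUntil]
    split_ifs
    · rw [List.map_cons, List.cons_prefix_cons]
      exact ⟨rfl, map_fst_serveUntil_prefix σ finish l _ _⟩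
    · exact List.nil_prefix

theorem serveUntil_congr {V : Type*} [MetricSpace V] {σ τ : RequestSeq V} (finish : ℝ) :
    ∀ (l : List ℕ), (∀ i ∈ l, σ.req i = τ.req i) → ∀ (pos : V) (t : ℝ),
      serveUntil σ finish pos t l = serveUntil τ finish pos t l
  | [], _, _, _ => rfl
  | i :: l, h, pos, t => by
    simp only [serveUntil, h i List.mem_cons_self,
      serveUntil_congr finish l (fun j hj => h j (List.mem_cons_of_mem _ hj))]

theorem le_start_of_mem_serveUntil {V : Type*} [MetricSpace V] (σ : RequestSeq V) (finish : ℝ) :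
    ∀ (l : List ℕ) (pos : V) (t : ℝ), ∀ x ∈ serveUntil σ finish pos t l,
      t + dist pos (σ.req x.1).node ≤ x.2
  | [], _, _, x, hx => absurd hx List.not_mem_nil
  | i :: l, pos, t, x, hx => by
    rw [serveUntil] at hx
    split_ifs at hx
    · rcases List.mem_cons.1 hx with rfl | hx
      · exact le_rfl
      · have := le_start_of_mem_serveUntil σ finish l _ _ x hx
        linarith [dist_triangle pos (σ.req i).node (σ.req x.1).node]
    · exact absurd hx List.not_mem_nil

theorem end_le_of_mem_serveUntil {V : Type*} [MetricSpace V] (σ : RequestSeq V) (finish : ℝ) :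
    ∀ (l : List ℕ) (pos : V) (t : ℝ), ∀ x ∈ serveUntil σ finish pos t l, x.2 + 1 ≤ finish
  | [], _, _, x, hx => absurd hx List.not_mem_nil
  | i :: l, pos, t, x, hx => by
    rw [serveUntil] at hx
    split_ifs at hx with h
    · rcases List.mem_cons.1 hx with rfl | hx
      · exact h
      · exact end_le_of_mem_serveUntil σ finish l _ _ x hx
    · exact absurd hx List.not_mem_nil

theorem pairwise_serveUntil {V : Type*} [MetricSpace V] (σ : RequestSeq V) (finish : ℝ) :
    ∀ (l : List ℕ) (pos : V) (t : ℝ), (serveUntil σ finish pos t l).Pairwise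
      (fun x y => x.2 + 1 + dist (σ.req x.1).node (σ.req y.1).node ≤ y.2)
  | [], _, _ => List.Pairwise.nil
  | i :: l, pos, t => by
    rw [serveUntil]
    split_ifs
    · exact List.pairwise_cons.2
        ⟨fun y hy => le_start_of_mem_serveUntil σ finish l _ _ y hy,
          pairwise_serveUntil σ finish l _ _⟩
    · exact List.Pairwise.nil

/-- If the travel along the whole list leaves time for `m` services, then `m` requests are served,
or all of them. -/
theorem min_le_length_serveUntil {V : Type*} [MetricSpace V] (σ : RequestSeq V) (finish : ℝ) :
    ∀ (l : List ℕ) (pos : V) (t : ℝ) (m : ℕ),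
      t + m + pathLength (pos :: l.map (fun i => (σ.req i).node)) ≤ finish →
      min m l.length ≤ (serveUntil σ finish pos t l).length
  | [], _, _, _, _ => by simp
  | _ :: _, _, _, 0, _ => by simp
  | i :: l, pos, t, m + 1, h => by
    simp only [List.map_cons, pathLength, Nat.cast_add, Nat.cast_one] at h
    have hpos := pathLength_nonneg ((σ.req i).node :: l.map (fun i => (σ.req i).node))
    have hm : (0 : ℝ) ≤ m := m.cast_nonneg
    rw [serveUntil, if_pos (by linarith), List.length_cons, List.length_cons]
    have := min_le_length_serveUntil σ finish l (σ.req i).node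
      (t + dist pos (σ.req i).node + 1) m (by linarith)
    omega

/-! ### Earliest deadline first -/

theorem edfBefore_trans {V : Type*} {K : ℝ} {σ : RequestSeq V} {i j l : ℕ}
    (h : edfBefore K σ i j) (h' : edfBefore K σ j l) : edfBefore K σ i l := by
  unfold edfBefore at *
  rcases h with h | ⟨h, hlt⟩ <;> rcases h' with h' | ⟨h', hlt'⟩
  · exact Or.inl (h.trans h')
  · exact Or.inl (h' ▸ h)
  · exact Or.inl (h ▸ h')
  · exact Or.inr ⟨h.trans h', hlt.trans hlt'⟩

theorem not_edfBefore_self {V : Type*} (K : ℝ) (σ : RequestSeq V) (i : ℕ) :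
    ¬ edfBefore K σ i i := by
  simp [edfBefore]

theorem edfBefore_or_eq_or {V : Type*} (K : ℝ) (σ : RequestSeq V) (i j : ℕ) :
    edfBefore K σ i j ∨ i = j ∨ edfBefore K σ j i := by
  unfold edfBefore
  rcases lt_trichotomy (decreasedDeadline K (σ.req i)) (decreasedDeadline K (σ.req j))
    with h | h | h
  · exact Or.inl (Or.inl h)
  · rcases lt_trichotomy i j with h' | h' | h'
    · exact Or.inl (Or.inr ⟨h, h'⟩)
    · exact Or.inr (Or.inl h')
    · exact Or.inr (Or.inr (Or.inr ⟨h.symm, h'⟩))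
  · exact Or.inr (Or.inr (Or.inl h))

open Classical in
theorem card_filter_edfBefore_lt {V : Type*} {K : ℝ} {σ : RequestSeq V} {R : Finset ℕ} {i j : ℕ}
    (hi : i ∈ R) (h : edfBefore K σ i j) :
    (R.filter (fun l => edfBefore K σ l i)).card <
      (R.filter (fun l => edfBefore K σ l j)).card := by
  apply Finset.card_lt_card
  rw [Finset.ssubset_iff_of_subset]
  · exact ⟨i, by simp [hi, h], by simp [not_edfBefore_self]⟩
  · intro l hl
    rw [Finset.mem_filter] at hl ⊢
    exact ⟨hl.1, edfBefore_trans hl.2 h⟩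

open Classical in
theorem injOn_card_filter_edfBefore {V : Type*} (K : ℝ) (σ : RequestSeq V) (R : Finset ℕ) :
    Set.InjOn (fun i => (R.filter (fun l => edfBefore K σ l i)).card) (R : Set ℕ) := by
  intro i hi j hj hij
  rcases edfBefore_or_eq_or K σ i j with h | h | h
  · exact absurd hij (card_filter_edfBefore_lt hi h).ne
  · exact h
  · exact absurd hij (card_filter_edfBefore_lt hj h).ne'

theorem card_edfPrefix_le {V : Type*} (K : ℝ) (σ : RequestSeq V) (R : Finset ℕ) :
    (edfPrefix K σ R).card ≤ ⌊K⌋₊ := by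
  classical
  rw [← Finset.card_range ⌊K⌋₊]
  refine Finset.card_le_card_of_injOn (fun i => (R.filter (fun l => edfBefore K σ l i)).card) ?_
    ((injOn_card_filter_edfBefore K σ R).mono ?_)
  · intro i hi
    simp only [edfPrefix, Finset.coe_filter, Set.mem_ofPred_eq] at hi
    simpa using hi.2
  · intro i hi
    simp only [edfPrefix, Finset.coe_filter, Set.mem_ofPred_eq] at hi
    exact hi.1

/-- A request is passed over only if the prefix is full. -/
theorem floor_le_card_edfPrefix {V : Type*} {K : ℝ} {σ : RequestSeq V} {R : Finset ℕ} {i : ℕ}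
    (hi : i ∈ R) (hi' : i ∉ edfPrefix K σ R) : ⌊K⌋₊ ≤ (edfPrefix K σ R).card := by
  classical
  set rank : ℕ → ℕ := fun i => (R.filter (fun l => edfBefore K σ l i)).card with hrank
  have hlt : ∀ j ∈ R, rank j < R.card := by
    intro j hj
    apply Finset.card_lt_card
    rw [Finset.filter_ssubset]
    exact ⟨j, hj, not_edfBefore_self K σ j⟩
  have hki : ⌊K⌋₊ ≤ rank i := by
    by_contra h
    exact hi' (by simpa [edfPrefix, hi] using h)
  -- The ranks are distinct and below the number of requests, so all these numbers occur.
  have himage : R.image rank = Finset.range R.card := by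
    apply Finset.eq_of_subset_of_card_le
    · intro n hn
      obtain ⟨j, hj, rfl⟩ := Finset.mem_image.1 hn
      exact Finset.mem_range.2 (hlt j hj)
    · rw [Finset.card_range, Finset.card_image_of_injOn (injOn_card_filter_edfBefore K σ R)]
  have hsub : Finset.range ⌊K⌋₊ ⊆ (edfPrefix K σ R).image rank := by
    intro n hn
    rw [Finset.mem_range] at hn
    have : n ∈ R.image rank := by
      rw [himage, Finset.mem_range]
      exact hn.trans (hki.trans_lt (hlt i hi))
    obtain ⟨j, hj, rfl⟩ := Finset.mem_image.1 this
    exact Finset.mem_image.2 ⟨j, by simpa [edfPrefix, hj] using hn, rfl⟩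
  calc ⌊K⌋₊ = (Finset.range ⌊K⌋₊).card := (Finset.card_range _).symm
    _ ≤ _ := Finset.card_le_card hsub
    _ ≤ _ := Finset.card_image_le

theorem edfBefore_of_mem_edfPrefix {V : Type*} {K : ℝ} {σ : RequestSeq V} {R : Finset ℕ} {i j : ℕ}
    (hi : i ∈ R) (hi' : i ∉ edfPrefix K σ R) (hj : j ∈ edfPrefix K σ R) : edfBefore K σ j i := by
  classical
  rcases edfBefore_or_eq_or K σ j i with h | rfl | h
  · exact h
  · exact absurd hj hi'
  · refine absurd ?_ hi'
    rw [edfPrefix, Finset.mem_filter] at hj ⊢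
    exact ⟨hi, (card_filter_edfBefore_lt hi h).trans hj.2⟩

/-- The charging argument for earliest-deadline-first selection in rounds, in which request `i` is
available from round `a i` until before round `b i`, and a request that is available but not
selected has to yield to `k` requests of no later deadline. If the number of requests of `O` with
windows inside an interval of rounds exceeds `k` times the length of that interval by a factor of
at most `c`, then `O` exceeds the selection by a factor of at most `c`.

Requests of `O` that are never selected are counted in the last round of their window. The interval
that is split off in the induction ends at the last deadline of such a request, and it is the
longest interval with that end in which every round is full and selects no later deadline. Whatever
is counted in it has its whole window in it. -/
theorem card_le_mul_sum_card_of_edf {a b : ℕ → ℕ} {S : ℕ → Finset ℕ} {k : ℕ} {c : ℝ}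
    {O : Finset ℕ} (hc : 1 ≤ c)
    (hedf : ∀ i ∈ O, ∀ p, a i ≤ p → p < b i → (∀ q ≤ p, i ∉ S q) →
      k ≤ (S p).card ∧ ∀ j ∈ S p, b j ≤ b i)
    (hwindow : ∀ i ∈ O, a i < b i)
    (hsel : ∀ p, ∀ i ∈ S p, p < b i)
    (hO : ∀ t e : ℕ, (∃ i ∈ O, t ≤ a i ∧ b i ≤ e) →
      ((O.filter (fun i => t ≤ a i ∧ b i ≤ e)).card : ℝ) ≤ c * (k * ((e : ℝ) - t)))
    (N : ℕ) (hN : ∀ i ∈ O, b i ≤ N) :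
    (O.card : ℝ) ≤ c * ∑ p ∈ Finset.range N, ((S p).card : ℝ) := by
  classical
  have key : ∀ N : ℕ,
      ((O.filter (fun i => (∃ p < N, i ∈ S p) ∨ ((∀ p, i ∉ S p) ∧ b i ≤ N))).card : ℝ) ≤
        c * ∑ p ∈ Finset.range N, ((S p).card : ℝ) := by
    intro N
    induction N using Nat.strong_induction_on with
    | _ N ih =>
    by_cases hU : (O.filter (fun i => (∀ p, i ∉ S p) ∧ b i ≤ N)).Nonempty
    · obtain ⟨i, hi, hmax⟩ := Finset.exists_max_image _ b hU
      obtain ⟨hiO, hiS, hiN⟩ := Finset.mem_filter.1 hi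
      have hex : ∃ t, ∀ p, t ≤ p → p < b i → k ≤ (S p).card ∧ ∀ j ∈ S p, b j ≤ b i :=
        ⟨b i, fun p h h' => absurd h' h.not_gt⟩
      obtain ⟨t, hfull, hmin⟩ : ∃ t,
          (∀ p, t ≤ p → p < b i → k ≤ (S p).card ∧ ∀ j ∈ S p, b j ≤ b i) ∧
          ∀ u < t, ¬ ∀ p, u ≤ p → p < b i → k ≤ (S p).card ∧ ∀ j ∈ S p, b j ≤ b i :=
        ⟨Nat.find hex, Nat.find_spec hex, fun u hu => Nat.find_min hex hu⟩
      have hta : t ≤ a i := by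
        by_contra h
        exact hmin (a i) (not_le.1 h) fun p hp hp' => hedf i hiO p hp hp' fun q _ => hiS q
      have hab := hwindow i hiO
      -- Otherwise `j` had to yield in round `t - 1`, and the interval could be extended by it.
      have hrelease : ∀ j ∈ O, (∀ q < t, j ∉ S q) → t < b j → b j ≤ b i → t ≤ a j := by
        intro j hjO hjS htj hji
        by_contra h
        have h1 := hedf j hjO (t - 1) (by omega) (by omega) fun q hq => hjS q (by omega)
        refine hmin (t - 1) (by omega) fun p hp hp' => ?_
        rcases hp.eq_or_lt with rfl | hp
        · exact ⟨h1.1, fun l hl => (h1.2 l hl).trans hji⟩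
        · exact hfull p (by omega) hp'
      have hsub : O.filter (fun i => (∃ p < N, i ∈ S p) ∨ ((∀ p, i ∉ S p) ∧ b i ≤ N)) ⊆
          (O.filter (fun i => (∃ p < t, i ∈ S p) ∨ ((∀ p, i ∉ S p) ∧ b i ≤ t)) ∪
            O.filter (fun j => t ≤ a j ∧ b j ≤ b i)) ∪ (Finset.Ico (b i) N).biUnion S := by
        intro j hj
        obtain ⟨hjO, hj⟩ := Finset.mem_filter.1 hj
        simp only [Finset.mem_union, Finset.mem_filter, Finset.mem_biUnion, Finset.mem_Ico, hjO,
          true_and]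
        by_cases hjt : ∃ p < t, j ∈ S p
        · exact Or.inl (Or.inl (Or.inl hjt))
        push Not at hjt
        rcases hj with ⟨p, hpN, hjp⟩ | ⟨hjS, hjN⟩
        · by_cases hpb : p < b i
          · have htp : t ≤ p := by
              by_contra h
              exact hjt p (not_le.1 h) hjp
            have hjb := (hfull p htp hpb).2 j hjp
            exact Or.inl (Or.inr ⟨hrelease j hjO hjt (htp.trans_lt (hsel p j hjp)) hjb, hjb⟩)
          · exact Or.inr ⟨p, ⟨not_lt.1 hpb, hpN⟩, hjp⟩
        · by_cases htj : b j ≤ t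
          · exact Or.inl (Or.inl (Or.inr ⟨hjS, htj⟩))
          · have hjb := hmax j (Finset.mem_filter.2 ⟨hjO, hjS, hjN⟩)
            exact Or.inl (Or.inr ⟨hrelease j hjO hjt (not_le.1 htj) hjb, hjb⟩)
      have hcard : ((O.filter
            (fun i => (∃ p < N, i ∈ S p) ∨ ((∀ p, i ∉ S p) ∧ b i ≤ N))).card : ℝ) ≤
          ((O.filter (fun i => (∃ p < t, i ∈ S p) ∨ ((∀ p, i ∉ S p) ∧ b i ≤ t))).card : ℝ) +
            ((O.filter (fun j => t ≤ a j ∧ b j ≤ b i)).card : ℝ) +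
            ∑ p ∈ Finset.Ico (b i) N, ((S p).card : ℝ) := by
        exact_mod_cast (Finset.card_le_card hsub).trans ((Finset.card_union_le _ _).trans
          (add_le_add (Finset.card_union_le _ _) Finset.card_biUnion_le))
      have h1 := ih t (by omega)
      have h2 := hO t (b i) ⟨i, hiO, hta, le_rfl⟩
      have h3 : (k : ℝ) * ((b i : ℝ) - t) ≤ ∑ p ∈ Finset.Ico t (b i), ((S p).card : ℝ) := by
        have := Finset.card_nsmul_le_sum (Finset.Ico t (b i)) (fun p => ((S p).card : ℝ)) k
          (fun p hp => by
            rw [Finset.mem_Ico] at hp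
            exact_mod_cast (hfull p hp.1 hp.2).1)
        rw [Nat.card_Ico, nsmul_eq_mul, Nat.cast_sub (by omega), mul_comm] at this
        exact this
      have h4 : ∑ p ∈ Finset.range N, ((S p).card : ℝ) =
          ∑ p ∈ Finset.range t, ((S p).card : ℝ) + ∑ p ∈ Finset.Ico t (b i), ((S p).card : ℝ) +
            ∑ p ∈ Finset.Ico (b i) N, ((S p).card : ℝ) := by
        rw [Finset.sum_range_add_sum_Ico _ (by omega), Finset.sum_range_add_sum_Ico _ (by omega)]
      have h5 : 0 ≤ ∑ p ∈ Finset.Ico (b i) N, ((S p).card : ℝ) :=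
        Finset.sum_nonneg fun p _ => Nat.cast_nonneg _
      rw [h4]
      nlinarith [mul_le_mul_of_nonneg_left h3 (zero_le_one.trans hc)]
    · have hsub : O.filter (fun i => (∃ p < N, i ∈ S p) ∨ ((∀ p, i ∉ S p) ∧ b i ≤ N)) ⊆
          (Finset.range N).biUnion S := by
        intro j hj
        obtain ⟨hjO, ⟨p, hp, hjp⟩ | hj⟩ := Finset.mem_filter.1 hj
        · exact Finset.mem_biUnion.2 ⟨p, Finset.mem_range.2 hp, hjp⟩
        · exact absurd ⟨j, Finset.mem_filter.2 ⟨hjO, hj⟩⟩ hU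
      have hcard : ((O.filter
            (fun i => (∃ p < N, i ∈ S p) ∨ ((∀ p, i ∉ S p) ∧ b i ≤ N))).card : ℝ) ≤
          ∑ p ∈ Finset.range N, ((S p).card : ℝ) := by
        exact_mod_cast (Finset.card_le_card hsub).trans Finset.card_biUnion_le
      exact hcard.trans (le_mul_of_one_le_left (Finset.sum_nonneg fun p _ => Nat.cast_nonneg _) hc)
  have hall : O.filter (fun i => (∃ p < N, i ∈ S p) ∨ ((∀ p, i ∉ S p) ∧ b i ≤ N)) = O := by
    refine Finset.filter_true_of_mem fun i hi => ?_
    by_cases h : ∃ p, i ∈ S p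
    · obtain ⟨p, hp⟩ := h
      exact Or.inl ⟨p, (hsel p i hp).trans_le (hN i hi), hp⟩
    · push Not at h
      exact Or.inr ⟨h, hN i hi⟩
  simpa only [hall] using key N

/-! ### The phases of the algorithm -/

theorem mem_handled_phaseState {V : Type*} [MetricSpace V] {K : ℝ} {order : List V} {v₀ : V}
    {σ : RequestSeq V} {i p : ℕ} : i ∈ (phaseState K order v₀ σ p).handled ↔
      ∃ q < p, i ∈ phaseSelection K σ q (phaseState K order v₀ σ q) := by
  induction p with
  | zero => simp [phaseState]
  | succ p ih =>
    simp only [phaseState, Finset.mem_union, ih]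
    constructor
    · rintro (⟨q, hq, h⟩ | h)
      · exact ⟨q, by omega, h⟩
      · exact ⟨p, by omega, h⟩
    · rintro ⟨q, hq, h⟩
      rcases Nat.lt_succ_iff_lt_or_eq.1 hq with hq | rfl
      · exact Or.inl ⟨q, hq, h⟩
      · exact Or.inr h

theorem mem_availableRequests_of_mem_phaseSelection {V : Type*} {K : ℝ} {σ : RequestSeq V}
    {p : ℕ} {st : ServerState V} {i : ℕ} (h : i ∈ phaseSelection K σ p st) :
    i ∈ availableRequests K σ p st.handled :=
  (Finset.mem_filter.1 h).1

theorem mem_phaseSelection_of_mem_phaseServices {V : Type*} [MetricSpace V] {K : ℝ}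
    {order : List V} {σ : RequestSeq V} {p : ℕ} {st : ServerState V} (h : IsNodeOrder order)
    {x : ℕ × ℝ} (hx : x ∈ phaseServices K order σ p st) : x.1 ∈ phaseSelection K σ p st :=
  (mem_nodeByNode h).1 ((map_fst_serveUntil_prefix _ _ _ _ _).subset
    (List.mem_map_of_mem (f := Prod.fst) hx))

theorem nodup_map_fst_phaseServices {V : Type*} [MetricSpace V] (K : ℝ)
    {order : List V} (σ : RequestSeq V) (p : ℕ) (st : ServerState V) (h : IsNodeOrder order) :
    ((phaseServices K order σ p st).map Prod.fst).Nodup :=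
  (nodup_nodeByNode σ _ h).sublist (map_fst_serveUntil_prefix _ _ _ _ _).sublist

theorem phase_le_start {V : Type*} [MetricSpace V] {K : ℝ} {order : List V} {σ : RequestSeq V}
    {p : ℕ} {st : ServerState V} {x : ℕ × ℝ} (hx : x ∈ phaseServices K order σ p st) :
    K * (p : ℝ) + dist st.pos (σ.req x.1).node ≤ x.2 :=
  le_start_of_mem_serveUntil _ _ _ _ _ x hx

theorem end_le_phase {V : Type*} [MetricSpace V] {K : ℝ} {order : List V} {σ : RequestSeq V}
    {p : ℕ} {st : ServerState V} {x : ℕ × ℝ} (hx : x ∈ phaseServices K order σ p st) :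
    x.2 + 1 ≤ K * ((p : ℝ) + 1) :=
  end_le_of_mem_serveUntil _ _ _ _ _ x hx

/-! ### The algorithm is online -/

theorem availableRequests_congr {V : Type*} {K t : ℝ} {σ τ : RequestSeq V}
    (h : AgreeUpTo t σ τ) {p : ℕ} (hp : K * (p : ℝ) ≤ t) (H : Finset ℕ) :
    availableRequests K σ p H = availableRequests K τ p H := by
  ext i
  simp only [availableRequests, Finset.mem_filter]
  constructor
  · rintro ⟨hi, hH, hr, hd⟩
    obtain ⟨hi', heq⟩ := h.1 i hi (hr.trans hp)
    rw [heq]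
    exact ⟨hi', hH, hr, hd⟩
  · rintro ⟨hi, hH, hr, hd⟩
    obtain ⟨hi', heq⟩ := h.2 i hi (hr.trans hp)
    rw [heq]
    exact ⟨hi', hH, hr, hd⟩

theorem edfPrefix_congr {V : Type*} (K : ℝ) {σ τ : RequestSeq V} {R : Finset ℕ}
    (h : ∀ i ∈ R, σ.req i = τ.req i) : edfPrefix K σ R = edfPrefix K τ R := by
  classical
  refine Finset.filter_congr fun i hi => ?_
  have : R.filter (fun j => edfBefore K σ j i) = R.filter (fun j => edfBefore K τ j i) :=
    Finset.filter_congr fun j hj => by rw [edfBefore, edfBefore, h i hi, h j hj]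
  rw [this]

theorem nodeByNode_congr {V : Type*} {σ τ : RequestSeq V} (order : List V) {S : Finset ℕ}
    (h : ∀ i ∈ S, σ.req i = τ.req i) : nodeByNode σ order S = nodeByNode τ order S := by
  classical
  unfold nodeByNode
  congr 1
  funext v
  have : S.filter (fun i => (σ.req i).node = v) = S.filter (fun i => (τ.req i).node = v) :=
    Finset.filter_congr fun i hi => by rw [h i hi]
  rw [this]

theorem req_eq_of_mem_availableRequests {V : Type*} {K t : ℝ} {σ τ : RequestSeq V}
    (h : AgreeUpTo t σ τ) {p : ℕ} (hp : K * (p : ℝ) ≤ t) {H : Finset ℕ} {i : ℕ}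
    (hi : i ∈ availableRequests K σ p H) : σ.req i = τ.req i := by
  obtain ⟨hi, -, hr, -⟩ := Finset.mem_filter.1 hi
  exact (h.1 i hi (hr.trans hp)).2.symm

theorem phaseSelection_congr {V : Type*} {K t : ℝ} {σ τ : RequestSeq V} (h : AgreeUpTo t σ τ)
    {p : ℕ} (hp : K * (p : ℝ) ≤ t) (st : ServerState V) :
    phaseSelection K σ p st = phaseSelection K τ p st := by
  rw [phaseSelection, phaseSelection, ← availableRequests_congr h hp]
  exact edfPrefix_congr K fun i hi => req_eq_of_mem_availableRequests h hp hi

theorem phaseServices_congr {V : Type*} [MetricSpace V] {K t : ℝ} {order : List V}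
    {σ τ : RequestSeq V} (h : AgreeUpTo t σ τ) (hord : IsNodeOrder order) {p : ℕ}
    (hp : K * (p : ℝ) ≤ t) (st : ServerState V) :
    phaseServices K order σ p st = phaseServices K order τ p st := by
  have hreq : ∀ i ∈ phaseSelection K σ p st, σ.req i = τ.req i := fun i hi =>
    req_eq_of_mem_availableRequests h hp (mem_availableRequests_of_mem_phaseSelection hi)
  rw [phaseServices, phaseServices, ← phaseSelection_congr h hp, ← nodeByNode_congr order hreq]
  exact serveUntil_congr _ _ (fun i hi => hreq i ((mem_nodeByNode hord).1 hi)) _ _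

theorem phaseState_congr {V : Type*} [MetricSpace V] {K t : ℝ} {order : List V} {v₀ : V}
    {σ τ : RequestSeq V} (h : AgreeUpTo t σ τ) (hord : IsNodeOrder order) (p : ℕ)
    (hp : ∀ q < p, K * (q : ℝ) ≤ t) :
    phaseState K order v₀ σ p = phaseState K order v₀ τ p := by
  induction p with
  | zero => rfl
  | succ p ih =>
    have hpt := hp p p.lt_succ_self
    simp only [phaseState, ← ih fun q hq => hp q (by omega), ← phaseSelection_congr h hpt,
      ← phaseServices_congr h hord hpt]
    congr 2
    refine Option.map_congr fun x hx => ?_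
    rw [req_eq_of_mem_availableRequests h hpt (mem_availableRequests_of_mem_phaseSelection
      (mem_phaseSelection_of_mem_phaseServices hord (List.mem_of_getLast? hx)))]

theorem isOnline_phaseSchedule {V : Type*} [MetricSpace V] {K : ℝ} (hK : 0 ≤ K) {order : List V}
    (v₀ : V) (hord : IsNodeOrder order) : IsOnline (phaseSchedule K order v₀) := by
  -- A service that starts by time `t` belongs to a phase that begins by time `t`.
  have hstep : ∀ (t : ℝ) (σ τ : RequestSeq V), AgreeUpTo t σ τ → ∀ (i : ℕ) (s : ℝ), s ≤ t →
      (i, s) ∈ phaseSchedule K order v₀ σ → (i, s) ∈ phaseSchedule K order v₀ τ := by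
    rintro t σ τ h i s hs ⟨p, hp⟩
    have hpt : K * (p : ℝ) ≤ t := by
      have := phase_le_start hp
      simp only at this
      linarith [dist_nonneg (x := (phaseState K order v₀ σ p).pos) (y := (σ.req i).node)]
    refine ⟨p, ?_⟩
    rwa [← phaseState_congr h hord p fun q hq =>
      (mul_le_mul_of_nonneg_left (Nat.cast_le.2 hq.le) hK).trans hpt,
      ← phaseServices_congr h hord hpt]
  exact fun t σ τ h i s hs => ⟨hstep t σ τ h i s hs, hstep t τ σ ⟨h.2, h.1⟩ i s hs⟩

/-! ### The schedule is feasible -/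

theorem decreasedDeadline_eq_mul_natFloor {V : Type*} {K : ℝ} (hK : 0 < K) (q : Request V) :
    decreasedDeadline K q = K * (⌊(q.deadline : ℝ) / K⌋₊ : ℝ) := by
  rw [decreasedDeadline, natCast_floor_eq_intCast_floor (by positivity)]

theorem decreasedDeadline_le {V : Type*} {K : ℝ} (hK : 0 < K) (q : Request V) :
    decreasedDeadline K q ≤ q.deadline := by
  rw [decreasedDeadline, ← le_div_iff₀' hK]
  exact Int.floor_le _

/-- The server has time to reach its position at the end of a phase within that phase. -/
theorem end_add_dist_pos_le_phase {V : Type*} [MetricSpace V] {K : ℝ} {order : List V} {v₀ : V}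
    {σ : RequestSeq V} {p : ℕ} {x : ℕ × ℝ}
    (hx : x ∈ phaseServices K order σ p (phaseState K order v₀ σ p)) :
    x.2 + 1 + dist (σ.req x.1).node (phaseState K order v₀ σ (p + 1)).pos ≤
      K * ((p : ℝ) + 1) := by
  obtain ⟨l, y, hl⟩ := List.eq_nil_or_concat'
    (phaseServices K order σ p (phaseState K order v₀ σ p)) |>.resolve_left (List.ne_nil_of_mem hx)
  have hpos : (phaseState K order v₀ σ (p + 1)).pos = (σ.req y.1).node := by
    simp [phaseState, hl]
  have hy : y.2 + 1 ≤ K * ((p : ℝ) + 1) := end_le_phase (by rw [hl]; simp)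
  have hpw : (phaseServices K order σ p (phaseState K order v₀ σ p)).Pairwise
      (fun x y => x.2 + 1 + dist (σ.req x.1).node (σ.req y.1).node ≤ y.2) :=
    pairwise_serveUntil _ _ _ _ _
  rw [hpos]
  rw [hl] at hx hpw
  rcases List.mem_append.1 hx with hx | hx
  · have := (List.pairwise_append.1 hpw).2.2 x hx y (by simp)
    linarith
  · rw [List.mem_singleton.1 hx, dist_self]
    linarith

/-- After a service, the server has time to reach its position at the beginning of any later
phase. -/
theorem end_add_dist_pos_le {V : Type*} [MetricSpace V] {K : ℝ} (hK : 0 ≤ K) {order : List V}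
    {v₀ : V} {σ : RequestSeq V} {p q : ℕ} (hpq : p < q) {x : ℕ × ℝ}
    (hx : x ∈ phaseServices K order σ p (phaseState K order v₀ σ p)) :
    x.2 + 1 + dist (σ.req x.1).node (phaseState K order v₀ σ q).pos ≤ K * (q : ℝ) := by
  induction q, hpq using Nat.le_induction with
  | base =>
    push_cast
    exact end_add_dist_pos_le_phase hx
  | succ q hq ih =>
    by_cases hl : phaseServices K order σ q (phaseState K order v₀ σ q) = []
    · have hpos : (phaseState K order v₀ σ (q + 1)).pos = (phaseState K order v₀ σ q).pos := by
        simp [phaseState, hl]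
      rw [hpos]
      push_cast
      linarith
    · obtain ⟨y, hy⟩ := List.exists_mem_of_ne_nil _ hl
      have h1 := phase_le_start hy
      have h2 := end_add_dist_pos_le_phase hy
      have h3 := dist_triangle4 (σ.req x.1).node (phaseState K order v₀ σ q).pos (σ.req y.1).node
        (phaseState K order v₀ σ (q + 1)).pos
      push_cast
      linarith

theorem feasible_phaseSchedule {V : Type*} [MetricSpace V] {K : ℝ} (hK : 0 < K) {order : List V}
    (v₀ : V) (hord : IsNodeOrder order) (σ : RequestSeq V) :
    Feasible σ (phaseSchedule K order v₀ σ) := by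
  have hmem : ∀ {x : ℕ × ℝ} {p : ℕ},
      x ∈ phaseServices K order σ p (phaseState K order v₀ σ p) →
      x.1 ∈ σ.ids ∧ x.1 ∉ (phaseState K order v₀ σ p).handled ∧
        ((σ.req x.1).release : ℝ) ≤ K * (p : ℝ) ∧
        K * ((p : ℝ) + 1) ≤ decreasedDeadline K (σ.req x.1) := fun hx =>
    Finset.mem_filter.1 (mem_availableRequests_of_mem_phaseSelection
      (mem_phaseSelection_of_mem_phaseServices hord hx))
  have hstart : ∀ {x : ℕ × ℝ} {p : ℕ},
      x ∈ phaseServices K order σ p (phaseState K order v₀ σ p) → K * (p : ℝ) ≤ x.2 := by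
    intro x p hx
    have := phase_le_start hx
    linarith [dist_nonneg (x := (phaseState K order v₀ σ p).pos) (y := (σ.req x.1).node)]
  have htravel : ∀ {x y : ℕ × ℝ} {p q : ℕ}, p < q →
      x ∈ phaseServices K order σ p (phaseState K order v₀ σ p) →
      y ∈ phaseServices K order σ q (phaseState K order v₀ σ q) →
      x.2 + 1 + dist (σ.req x.1).node (σ.req y.1).node ≤ y.2 := by
    intro x y p q hpq hx hy
    have h1 := end_add_dist_pos_le hK.le hpq hx
    have h2 := phase_le_start hy
    linarith [dist_triangle (σ.req x.1).node (phaseState K order v₀ σ q).pos (σ.req y.1).node]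
  refine ⟨?_, ?_, ?_, ?_, ?_⟩
  · rintro x ⟨p, hx⟩
    exact (hmem hx).1
  · rintro x ⟨p, hx⟩
    exact (hmem hx).2.2.1.trans (hstart hx)
  · rintro x ⟨p, hx⟩
    exact ((end_le_phase hx).trans (hmem hx).2.2.2).trans (decreasedDeadline_le hK _)
  · rintro x ⟨p, hx⟩ y ⟨q, hy⟩ hxy
    have hne : ∀ {x y : ℕ × ℝ} {p q : ℕ}, p < q →
        x ∈ phaseServices K order σ p (phaseState K order v₀ σ p) →
        y ∈ phaseServices K order σ q (phaseState K order v₀ σ q) → x.1 ≠ y.1 := by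
      intro x y p q hpq hx hy hxy
      refine (hmem hy).2.1 (mem_handled_phaseState.2 ⟨p, hpq, ?_⟩)
      rw [← hxy]
      exact mem_phaseSelection_of_mem_phaseServices hord hx
    rcases lt_trichotomy p q with h | rfl | h
    · exact absurd hxy (hne h hx hy)
    · exact List.inj_on_of_nodup_map (nodup_map_fst_phaseServices K σ p _ hord) hx hy hxy
    · exact absurd hxy.symm (hne h hy hx)
  · rintro x ⟨p, hx⟩ y ⟨q, hy⟩ hxy hle
    rcases lt_trichotomy p q with h | rfl | h
    · exact htravel h hx hy
    · have hpw : (phaseServices K order σ p (phaseState K order v₀ σ p)).Pairwise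
          (fun x y => x.2 + 1 + dist (σ.req x.1).node (σ.req y.1).node ≤ y.2) :=
        pairwise_serveUntil _ _ _ _ _
      -- Within a phase the services are listed in the order of time, and the relation is made
      -- symmetric by quantifying over both orders.
      have hsymm : Std.Symm (fun x y : ℕ × ℝ =>
          (x.2 ≤ y.2 → x.2 + 1 + dist (σ.req x.1).node (σ.req y.1).node ≤ y.2) ∧
            (y.2 ≤ x.2 → y.2 + 1 + dist (σ.req y.1).node (σ.req x.1).node ≤ x.2)) :=
        ⟨fun _ _ h => ⟨h.2, h.1⟩⟩
      have hpw' : (phaseServices K order σ p (phaseState K order v₀ σ p)).Pairwise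
          (fun x y : ℕ × ℝ =>
            (x.2 ≤ y.2 → x.2 + 1 + dist (σ.req x.1).node (σ.req y.1).node ≤ y.2) ∧
              (y.2 ≤ x.2 → y.2 + 1 + dist (σ.req y.1).node (σ.req x.1).node ≤ x.2)) := by
        refine hpw.imp fun {x y} h => ⟨fun _ => h, fun h' => ?_⟩
        linarith [dist_nonneg (x := (σ.req x.1).node) (y := (σ.req y.1).node)]
      exact (hpw'.forall hx hy hxy).1 hle
    · have := htravel h hy hx
      linarith [dist_nonneg (x := (σ.req y.1).node) (y := (σ.req x.1).node)]

/-! ### The optimal schedule -/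

theorem Feasible.injOn_fst {V : Type*} [MetricSpace V] {σ : RequestSeq V} {A : Schedule}
    (hA : Feasible σ A) : Set.InjOn Prod.fst A :=
  fun x hx y hy h => hA.once x hx y hy h

theorem Feasible.finite {V : Type*} [MetricSpace V] {σ : RequestSeq V} {A : Schedule}
    (hA : Feasible σ A) : A.Finite :=
  Set.Finite.of_injOn (fun x hx => hA.mem_ids x hx) hA.injOn_fst σ.ids.finite_toSet

/-- Each service takes one unit of time, so that requests that are served and have their windows in
`[u, w]` number at most `w - u`. -/
theorem Feasible.card_le_sub {V : Type*} [MetricSpace V] {σ : RequestSeq V} {A : Schedule}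
    (hA : Feasible σ A) {F : Finset ℕ} {u w : ℝ} (huw : u ≤ w)
    (hF : ∀ i ∈ F, ∃ s : ℝ, (i, s) ∈ A) (hu : ∀ i ∈ F, u ≤ ((σ.req i).release : ℝ))
    (hw : ∀ i ∈ F, ((σ.req i).deadline : ℝ) ≤ w) : (F.card : ℝ) ≤ w - u := by
  choose! s hs using hF
  have hlo : ∀ i ∈ F, 0 ≤ s i - u := fun i hi => by
    have := hA.release_le _ (hs i hi)
    simp only at this
    linarith [hu i hi]
  have hhi : ∀ i ∈ F, s i - u + 1 ≤ w - u := fun i hi => by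
    have := hA.le_deadline _ (hs i hi)
    simp only at this
    linarith [hw i hi]
  have hne : ∀ i ∈ F, ∀ j ∈ F, i ≠ j → s i ≤ s j → ⌊s i - u⌋₊ ≠ ⌊s j - u⌋₊ := by
    intro i hi j hj hij hle heq
    have h1 := hA.travel _ (hs i hi) _ (hs j hj) (fun h => hij (congrArg Prod.fst h)) hle
    simp only at h1
    have h2 := Nat.floor_le (hlo i hi)
    have h3 := Nat.lt_floor_add_one (s j - u)
    rw [← heq] at h3
    linarith [dist_nonneg (x := (σ.req i).node) (y := (σ.req j).node)]
  have hcard : F.card ≤ (Finset.range ⌊w - u⌋₊).card := by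
    refine Finset.card_le_card_of_injOn (fun i => ⌊s i - u⌋₊) ?_ ?_
    · intro i hi
      simp only [Finset.coe_range, Set.mem_Iio]
      refine Nat.lt_of_succ_le (Nat.le_floor ?_)
      push_cast
      linarith [Nat.floor_le (hlo i hi), hhi i hi]
    · intro i hi j hj heq
      by_contra hij
      rcases le_total (s i) (s j) with h | h
      · exact hne i hi j hj hij h heq
      · exact hne j hj i hi (Ne.symm hij) h heq.symm
  rw [Finset.card_range] at hcard
  exact (Nat.cast_le.2 hcard).trans (Nat.floor_le (sub_nonneg.2 huw))

/-! ### The throughput of the algorithm -/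

theorem sum_length_phaseServices_le {V : Type*} [MetricSpace V] {K : ℝ} (hK : 0 < K)
    {order : List V} (v₀ : V) (hord : IsNodeOrder order) (σ : RequestSeq V) (N : ℕ) :
    ∑ p ∈ Finset.range N, (phaseServices K order σ p (phaseState K order v₀ σ p)).length ≤
      throughput (phaseSchedule K order v₀ σ) := by
  classical
  have hnodup : ∀ p, (phaseServices K order σ p (phaseState K order v₀ σ p)).Nodup := fun p =>
    (nodup_map_fst_phaseServices K σ p _ hord).of_map
  have hdisj : ∀ p q : ℕ, p < q → ∀ x ∈ phaseServices K order σ p (phaseState K order v₀ σ p),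
      x ∉ phaseServices K order σ q (phaseState K order v₀ σ q) := by
    intro p q hpq x hx hx'
    have h1 := end_le_phase hx
    have h2 := phase_le_start hx'
    have h3 : K * ((p : ℝ) + 1) ≤ K * (q : ℝ) :=
      mul_le_mul_of_nonneg_left (by exact_mod_cast hpq) hK.le
    linarith [dist_nonneg (x := (phaseState K order v₀ σ q).pos) (y := (σ.req x.1).node)]
  calc ∑ p ∈ Finset.range N, (phaseServices K order σ p (phaseState K order v₀ σ p)).length
      = ∑ p ∈ Finset.range N,
          (phaseServices K order σ p (phaseState K order v₀ σ p)).toFinset.card :=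
        Finset.sum_congr rfl fun p _ => (List.toFinset_card_of_nodup (hnodup p)).symm
    _ = ((Finset.range N).biUnion fun p =>
          (phaseServices K order σ p (phaseState K order v₀ σ p)).toFinset).card := by
        rw [Finset.card_biUnion]
        intro p _ q _ hpq
        rw [Function.onFun, Finset.disjoint_left]
        intro x hx hx'
        rw [List.mem_toFinset] at hx hx'
        rcases lt_or_gt_of_ne hpq with h | h
        · exact hdisj p q h x hx hx'
        · exact hdisj q p h x hx' hx
    _ ≤ throughput (phaseSchedule K order v₀ σ) := by
        rw [throughput, ← Set.ncard_coe_finset]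
        refine Set.ncard_le_ncard ?_ (feasible_phaseSchedule hK v₀ hord σ).finite
        intro x hx
        obtain ⟨p, -, hx⟩ := Finset.mem_biUnion.1 (Finset.mem_coe.1 hx)
        exact ⟨p, List.mem_toFinset.1 hx⟩

/-- A phase loses at most the travel time along a minimum path or tour, twice, of its length. -/
theorem min_le_length_phaseServices {V : Type*} [Fintype V] [MetricSpace V] {kind : TSPKind}
    {K : ℝ} {order : List V} (hmin : IsMinimalTSP kind order) (σ : RequestSeq V) (p : ℕ)
    (st : ServerState V) {m : ℕ} (hm : (m : ℝ) + 2 * tspWeight V kind ≤ K) :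
    min m (phaseSelection K σ p st).card ≤ (phaseServices K order σ p st).length := by
  rw [← length_nodeByNode σ (phaseSelection K σ p st) hmin.1]
  refine min_le_length_serveUntil _ _ _ _ _ _ ?_
  linarith [pathLength_nodeByNode_le hmin σ (phaseSelection K σ p st) st.pos]

/-- The selections of the phases are an earliest-deadline-first selection in which a request with
window `[r, d]` is available from phase `⌈r / K⌉` until before phase `⌊d / K⌋`. A long window loses
at most two phases by this rounding, so that few requests of an optimal schedule are not
selected. -/
theorem opt_le_mul_sum_card_phaseSelection {V : Type*} [MetricSpace V] {K L c : ℝ} (hK : 0 < K)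
    (hL : 2 * K < L) (hc : 1 ≤ c)
    (hload : ∀ n : ℕ, L < K * ((n : ℝ) + 2) → K * ((n : ℝ) + 2) ≤ c * (⌊K⌋₊ * (n : ℝ)))
    (order : List V) (v₀ : V) {σ : RequestSeq V} (hσ : HasLaxity L σ) :
    ∃ N : ℕ, (opt σ : ℝ) ≤
      c * ∑ p ∈ Finset.range N, ((phaseSelection K σ p (phaseState K order v₀ σ p)).card : ℝ) := by
  classical
  obtain ⟨⟨A, hA, hopt⟩, -⟩ := opt_isGreatest σ
  set O : Finset ℕ := hA.finite.toFinset.image Prod.fst with hOdef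
  have hO : ∀ i ∈ O, ∃ s : ℝ, (i, s) ∈ A := by
    intro i hi
    obtain ⟨x, hx, rfl⟩ := Finset.mem_image.1 hi
    exact ⟨x.2, hA.finite.mem_toFinset.1 hx⟩
  have hOids : ∀ i ∈ O, i ∈ σ.ids := fun i hi => (hO i hi).elim fun s hs => hA.mem_ids _ hs
  have hcard : O.card = opt σ := by
    rw [hOdef, Finset.card_image_of_injOn (by simpa using hA.injOn_fst), ← hopt, throughput,
      Set.ncard_eq_toFinset_card A hA.finite]
  set a : ℕ → ℕ := fun i => ⌈((σ.req i).release : ℝ) / K⌉₊ with ha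
  set b : ℕ → ℕ := fun i => ⌊((σ.req i).deadline : ℝ) / K⌋₊ with hb
  have hrelease : ∀ i, K * ((a i : ℝ) - 1) ≤ ((σ.req i).release : ℝ) := by
    intro i
    rw [← le_div_iff₀' hK]
    linarith [Nat.ceil_lt_add_one (a := ((σ.req i).release : ℝ) / K) (by positivity)]
  have hdeadline : ∀ i, ((σ.req i).deadline : ℝ) < K * ((b i : ℝ) + 1) := by
    intro i
    rw [← div_lt_iff₀' hK]
    exact Nat.lt_floor_add_one _
  have hdd : ∀ i, decreasedDeadline K (σ.req i) = K * (b i : ℝ) := fun i =>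
    decreasedDeadline_eq_mul_natFloor hK _
  have hlen : ∀ i ∈ O, L < K * ((b i : ℝ) - a i + 2) := by
    intro i hi
    have := hσ i (hOids i hi)
    linarith [hrelease i, hdeadline i]
  obtain ⟨N, hN⟩ : ∃ N, ∀ i ∈ O, b i ≤ N := ⟨O.sup b, fun i hi => Finset.le_sup hi⟩
  refine ⟨N, ?_⟩
  rw [← hcard]
  refine card_le_mul_sum_card_of_edf (a := a) (b := b) (k := ⌊K⌋₊) hc ?_ ?_ ?_ ?_ N hN
  · intro i hi p hap hpb hnot
    have hav : i ∈ availableRequests K σ p (phaseState K order v₀ σ p).handled := by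
      refine Finset.mem_filter.2 ⟨hOids i hi, ?_, ?_, ?_⟩
      · rw [mem_handled_phaseState]
        rintro ⟨q, hq, h⟩
        exact hnot q hq.le h
      · rw [← div_le_iff₀' hK]
        exact Nat.ceil_le.1 hap
      · rw [hdd]
        exact mul_le_mul_of_nonneg_left (by exact_mod_cast hpb) hK.le
    refine ⟨floor_le_card_edfPrefix hav (hnot p le_rfl), fun j hj => ?_⟩
    have hle : decreasedDeadline K (σ.req j) ≤ decreasedDeadline K (σ.req i) :=
      (edfBefore_of_mem_edfPrefix hav (hnot p le_rfl) hj).elim le_of_lt fun h => h.1.le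
    rw [hdd, hdd, mul_le_mul_iff_right₀ hK] at hle
    exact_mod_cast hle
  · intro i hi
    have h : (0 : ℝ) < K * ((b i : ℝ) - a i) := by linarith [hlen i hi]
    have := (mul_pos_iff_of_pos_left hK).1 h
    exact_mod_cast sub_pos.1 this
  · intro p i hi
    have h := (Finset.mem_filter.1 (mem_availableRequests_of_mem_phaseSelection hi)).2.2.2
    rw [hdd, mul_le_mul_iff_right₀ hK] at h
    exact_mod_cast h
  · rintro t e ⟨i, hi, hti, hie⟩
    have hti' : (t : ℝ) ≤ a i := by exact_mod_cast hti
    have hie' : (b i : ℝ) ≤ e := by exact_mod_cast hie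
    have hlong : L < K * ((e : ℝ) - t + 2) :=
      (hlen i hi).trans_le (mul_le_mul_of_nonneg_left (by linarith) hK.le)
    have hte : (t : ℝ) < e := by
      have h : (0 : ℝ) < K * ((e : ℝ) - t) := by linarith
      exact sub_pos.1 ((mul_pos_iff_of_pos_left hK).1 h)
    have hcast : ((e - t : ℕ) : ℝ) = (e : ℝ) - t := Nat.cast_sub (by exact_mod_cast hte.le)
    have h1 := hload (e - t) (by rwa [hcast])
    rw [hcast] at h1
    -- Requests available only from phase `t` until before phase `e` have their windows inside the
    -- interval that is longer by one phase on both sides.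
    have h2 := hA.card_le_sub (F := O.filter (fun i => t ≤ a i ∧ b i ≤ e))
      (u := K * ((t : ℝ) - 1)) (w := K * ((e : ℝ) + 1))
      (mul_le_mul_of_nonneg_left (by linarith) hK.le)
      (fun j hj => hO j (Finset.mem_filter.1 hj).1)
      (fun j hj => (mul_le_mul_of_nonneg_left (sub_le_sub_right
        (Nat.cast_le.2 (Finset.mem_filter.1 hj).2.1) 1) hK.le).trans (hrelease j))
      (fun j hj => (hdeadline j).le.trans (mul_le_mul_of_nonneg_left (add_le_add_left
        (Nat.cast_le.2 (Finset.mem_filter.1 hj).2.2) 1) hK.le))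
    refine h2.trans (le_trans (le_of_eq ?_) h1)
    ring

/-! ### The competitive ratio -/

theorem mainTheorem2 :
    ∃ C : ℝ, 0 < C ∧
      ∀ (V : Type*) [Fintype V] [MetricSpace V] (kind : TSPKind) (L : ℝ) (order : List V) (v₀ : V),
        1 ≤ tspWeight V kind →
        10 * tspWeight V kind < L →
        IsMinimalTSP kind order →
          IsOnline (tspEDF kind L order v₀) ∧
          (∀ σ : RequestSeq V, Feasible σ (tspEDF kind L order v₀ σ)) ∧
          IsCompetitive (tspEDF kind L order v₀) L
            (1 + C * Real.sqrt (tspWeight V kind / L)) := by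
  -- The two losses are factors `1 + 12 * e` and `1 + 100 * e`, and `e < 0.317`.
  refine ⟨500, by norm_num, ?_⟩
  intro V _ _ kind L order v₀ hT hL hmin
  unfold tspEDF
  set T := tspWeight V kind with hTdef
  set K := Real.sqrt (T * L) with hKdef
  set e := Real.sqrt (T / L) with hedef
  have hT0 : 0 < T := by linarith
  have hL0 : 0 < L := by linarith
  have hK : 0 < K := Real.sqrt_pos.2 (by positivity)
  have he : 0 < e := Real.sqrt_pos.2 (by positivity)
  have hTe : T = e * K := by
    rw [hedef, hKdef, ← Real.sqrt_mul (by positivity), div_mul_eq_mul_div, ← mul_assoc,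
      mul_div_cancel_right₀ _ hL0.ne', Real.sqrt_mul_self hT0.le]
  have hKe : K = e * L := by
    rw [hKdef, hedef, Real.sqrt_eq_iff_mul_self_eq (by positivity) (by positivity),
      mul_mul_mul_comm, Real.mul_self_sqrt (by positivity)]
    field_simp
  have he_sq : e ^ 2 < 1 / 10 := by
    rw [hedef, Real.sq_sqrt (by positivity), div_lt_div_iff₀ hL0 (by norm_num)]
    linarith
  have he1 : e < 0.317 := by nlinarith
  refine ⟨isOnline_phaseSchedule hK.le v₀ hmin.1,
    feasible_phaseSchedule hK v₀ hmin.1, fun σ hσ => ?_⟩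
  -- An interval of `n` phases that contains a window has `1 < e * (n + 2)`, so that the two
  -- additional phases amount to a fraction `O(e)` of it; the rounding of `K` to `⌊K⌋` does as well,
  -- because of `1 ≤ T = e * K`.
  obtain ⟨N, hopt⟩ := opt_le_mul_sum_card_phaseSelection (c := 1 + 12 * e) hK
    (by rw [hKe]; nlinarith) (by linarith)
    (by
      intro n hn
      have hn0 : (0 : ℝ) ≤ n := n.cast_nonneg
      have h1 : 1 < e * ((n : ℝ) + 2) := by
        rw [hKe, mul_right_comm] at hn
        exact (lt_mul_iff_one_lt_left hL0).1 hn
      have h2 : (n : ℝ) + 2 ≤ (1 + 6 * e) * n := by nlinarith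
      have h3 : K * (1 - e) ≤ ⌊K⌋₊ := by linarith [Nat.lt_floor_add_one K]
      calc K * ((n : ℝ) + 2) ≤ K * ((1 + 6 * e) * n) := mul_le_mul_of_nonneg_left h2 hK.le
        _ ≤ K * (((1 + 12 * e) * (1 - e)) * n) := by
          refine mul_le_mul_of_nonneg_left (mul_le_mul_of_nonneg_right ?_ hn0) hK.le
          nlinarith
        _ = (1 + 12 * e) * (K * (1 - e) * n) := by ring
        _ ≤ (1 + 12 * e) * (⌊K⌋₊ * (n : ℝ)) :=
          mul_le_mul_of_nonneg_left (mul_le_mul_of_nonneg_right h3 hn0) (by linarith))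
    order v₀ hσ
  -- The travel in a phase and the rounding cost at most `2 * T + 1 ≤ 3 * e * K` units of time.
  have hphase : ∀ p, ((phaseSelection K σ p (phaseState K order v₀ σ p)).card : ℝ) ≤
      (1 + 100 * e) * ((phaseServices K order σ p (phaseState K order v₀ σ p)).length : ℝ) := by
    intro p
    have hKT : 0 ≤ K - 2 * T := by rw [hTe]; nlinarith
    have h1 := min_le_length_phaseServices hmin σ p (phaseState K order v₀ σ p)
      (m := ⌊K - 2 * T⌋₊) (K := K) (by linarith [Nat.floor_le hKT])
    have h2 := Nat.lt_floor_add_one (K - 2 * T)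
    rcases min_le_iff.1 h1 with h | h
    · have h3 : ((phaseSelection K σ p (phaseState K order v₀ σ p)).card : ℝ) ≤ K :=
        (Nat.cast_le.2 (card_edfPrefix_le K σ _)).trans (Nat.floor_le hK.le)
      have h4 : K * (1 - 3 * e) ≤
          ((phaseServices K order σ p (phaseState K order v₀ σ p)).length : ℝ) := by
        refine le_trans ?_ (Nat.cast_le.2 h)
        linarith
      calc ((phaseSelection K σ p (phaseState K order v₀ σ p)).card : ℝ) ≤ K := h3
        _ ≤ K * ((1 + 100 * e) * (1 - 3 * e)) :=
          le_mul_of_one_le_right hK.le (by nlinarith)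
        _ = (1 + 100 * e) * (K * (1 - 3 * e)) := by ring
        _ ≤ _ := mul_le_mul_of_nonneg_left h4 (by linarith)
    · exact (Nat.cast_le.2 h).trans
        (le_mul_of_one_le_left (Nat.cast_nonneg _) (by linarith))
  have hserved : ∑ p ∈ Finset.range N,
      ((phaseServices K order σ p (phaseState K order v₀ σ p)).length : ℝ) ≤
        (throughput (phaseSchedule K order v₀ σ) : ℝ) := by
    exact_mod_cast sum_length_phaseServices_le hK v₀ hmin.1 σ N
  have h12 : 0 ≤ 1 + 12 * e := by linarith
  have h100 : 0 ≤ 1 + 100 * e := by linarith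
  calc (opt σ : ℝ) ≤ (1 + 12 * e) * ∑ p ∈ Finset.range N,
        ((phaseSelection K σ p (phaseState K order v₀ σ p)).card : ℝ) := hopt
    _ ≤ (1 + 12 * e) * ((1 + 100 * e) * ∑ p ∈ Finset.range N,
        ((phaseServices K order σ p (phaseState K order v₀ σ p)).length : ℝ)) := by
      rw [Finset.mul_sum _ _ (1 + 100 * e)]
      exact mul_le_mul_of_nonneg_left (Finset.sum_le_sum fun p _ => hphase p) h12
    _ ≤ (1 + 12 * e) * ((1 + 100 * e) * (throughput (phaseSchedule K order v₀ σ) : ℝ)) :=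
      mul_le_mul_of_nonneg_left (mul_le_mul_of_nonneg_left hserved h100) h12
    _ = ((1 + 12 * e) * (1 + 100 * e)) * (throughput (phaseSchedule K order v₀ σ) : ℝ) := by ring
    _ ≤ (1 + 500 * e) * (throughput (phaseSchedule K order v₀ σ) : ℝ) :=
      mul_le_mul_of_nonneg_right (by nlinarith) (Nat.cast_nonneg _)
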